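/- Fix real numbers $0\le u<\hat u<1$. Let $(Y^*(v),\,0\le v\le 1)$ be a real-valued stochastic process and define $$X^*(v)=\frac{1-u-v(\hat u-u)}{\sqrt{(1-u)(1-\hat u)}}\;Y^*\!\left(\frac{(1-\hat u)\,v}{1-u-v(\hat u-u)}\right),\qquad 0\le v\le 1.$$ (The time argument of $Y^*$ lies in $[0,1]$ for every $v\in[0,1]$.) (i) If $Y^*$ is a standard Brownian bridge (a centred Gaussian process with $\mathbb E[Y^*(s)Y^*(t)]=s(1-t)$ for $0\le s\le t\le 1$ and almost surely continuous paths), then $(X^*(v),0\le v\le1)$ has almost surely continuous paths and the same distribution as $(Y^*(v),0\le v\le 1)$. (ii) The same holds if $Y^*$ is a standard Brownian excursion, i.e. an almost surely continuous process with $Y^*(0)=Y^*(1)=0$ almost surely whose finite-dimensional distributions at times $0<t_0<\dots<t_n<1$ have the density $$\sqrt{8\pi}\;h_{t_0}(x_0)\prod_{i=0}^{n-1}p_{t_{i+1}-t_i}(x_i,x_{i+1})\;h_{1-t_n}(x_n),\qquad x_0,\dots,x_n>0,$$ where $h_t(x)=\frac{x}{\sqrt{2\pi t^3}}e^{-x^2/2t}$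 and $p_t(x,y)=\frac{1}{\sqrt{2\pi t}}\bigl(e^{-(x-y)^2/2t}-e^{-(x+y)^2/2t}\bigr)$. (iii) The same holds if $Y^*$ is a standard Bessel bridge of any real dimension $d>0$, i.e. the Bessel process of dimension $d$ started at $0$ and conditioned to be at $0$ at time $1$: an almost surely continuous process with $Y^*(0)=Y^*(1)=0$ almost surely whose finite-dimensional distributions at times $0<t_0<\dots<t_n<1$ have the density $$\frac{q_{t_0}(0,x_0)\,\prod_{i=0}^{n-1}q_{t_{i+1}-t_i}(x_i,x_{i+1})\;q_{1-t_n}(x_n,0)}{q_1(0,0)}\prod_{i=0}^n x_i^{d-1},\qquad x_0,\dots,x_n>0,$$ where $q_t(x,y)=2^{1-d/2}\,t^{-d/2}\,e^{-(x^2+y^2)/2t}\sum_{k\ge0}\frac{(xy/2t)^{2k}}{k!\,\Gamma(k+d/2)}$ is the transition density of the Bessel process with respect to $y^{d-1}\,dy$. -/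

import Mathlib

open MeasureTheory ProbabilityTheory

/-! ### The space-time map -/

/-- The image under the time change `v ↦ (1 - uhat) v / (1 - u - v (uhat - u))` of a point of the
unit interval lies in the unit interval. -/
theorem timeChange_mem {u uhat : ℝ} (h : u < uhat) (hhat : uhat < 1) (v : unitInterval) :
    (1 - uhat) * (v : ℝ) / (1 - u - v * (uhat - u)) ∈ unitInterval := by
  have h0 : (0 : ℝ) ≤ v := v.2.1
  have h1 : (v : ℝ) ≤ 1 := v.2.2
  have hpos : 0 < 1 - u - v * (uhat - u) := by nlinarith
  refine ⟨div_nonneg (mul_nonneg (by linarith) h0) hpos.le, ?_⟩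
  rw [div_le_one hpos]
  nlinarith

/-- The time change `v ↦ (1 - uhat) v / (1 - u - v (uhat - u))` of `[0,1]`. -/
noncomputable def timeChange {u uhat : ℝ} (h : u < uhat) (hhat : uhat < 1)
    (v : unitInterval) : unitInterval :=
  ⟨(1 - uhat) * (v : ℝ) / (1 - u - v * (uhat - u)), timeChange_mem h hhat v⟩

/-- The process
`X v = (1 - u - v (uhat - u)) / √((1 - u) (1 - uhat)) * Y ((1 - uhat) v / (1 - u - v (uhat - u)))`,
for `0 ≤ v ≤ 1`. -/
noncomputable def bridgeTransform {Ω : Type*} {u uhat : ℝ} (h : u < uhat) (hhat : uhat < 1)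
    (Y : unitInterval → Ω → ℝ) (v : unitInterval) (ω : Ω) : ℝ :=
  (1 - u - v * (uhat - u)) / √((1 - u) * (1 - uhat)) * Y (timeChange h hhat v) ω

/-! ### Standard Brownian bridge -/

/-- A standard Brownian bridge: a centred Gaussian process indexed by `[0,1]` with covariance
`s (1 - t)` for `s ≤ t`, and with almost surely continuous paths. -/
structure IsStdBrownianBridge {Ω : Type*} {mΩ : MeasurableSpace Ω}
    (Y : unitInterval → Ω → ℝ) (P : Measure Ω) : Prop where
  isGaussianProcess : IsGaussianProcess Y P
  mean_eq_zero : ∀ t, ∫ ω, Y t ω ∂P = 0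
  covariance_eq : ∀ s t : unitInterval, s ≤ t →
    covariance (Y s) (Y t) P = (s : ℝ) * (1 - (t : ℝ))
  continuous_paths : ∀ᵐ ω ∂P, Continuous fun t ↦ Y t ω

/-! ### Finite dimensional densities of Markovian bridges of length one -/

/-- The function
`a(t₀, x₀) * (∏ i < n, p(tᵢ₊₁ - tᵢ, xᵢ, xᵢ₊₁)) * b(1 - tₙ, xₙ)`
of the space points `x₀, …, xₙ`, for times `t₀ < ⋯ < tₙ` in `(0,1)`: `a` is an entrance law, `p` a
transition density and `b` the weight of the remaining path, of length `1 - tₙ`. -/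
noncomputable def chainDensity (a : ℝ → ℝ → ℝ) (p : ℝ → ℝ → ℝ → ℝ) (b : ℝ → ℝ → ℝ) {n : ℕ}
    (t : Fin (n + 1) → unitInterval) (x : Fin (n + 1) → ℝ) : ℝ :=
  a (t 0) (x 0) *
    (∏ i : Fin n, p ((t i.succ : ℝ) - (t i.castSucc : ℝ)) (x i.castSucc) (x i.succ)) *
    b (1 - (t (Fin.last n) : ℝ)) (x (Fin.last n))

/-- `Y` starts and ends at `0`, has almost surely continuous paths, and for all times
`0 < t₀ < ⋯ < tₙ < 1` the vector `(Y t₀, …, Y tₙ)` has on `(0,∞)ⁿ⁺¹` the density `chainDensity a p b`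
with respect to Lebesgue measure. -/
structure IsPositiveBridgeWith {Ω : Type*} {mΩ : MeasurableSpace Ω}
    (a : ℝ → ℝ → ℝ) (p : ℝ → ℝ → ℝ → ℝ) (b : ℝ → ℝ → ℝ)
    (Y : unitInterval → Ω → ℝ) (P : Measure Ω) : Prop where
  start_eq_zero : ∀ᵐ ω ∂P, Y 0 ω = 0
  end_eq_zero : ∀ᵐ ω ∂P, Y 1 ω = 0
  hasLaw : ∀ (n : ℕ) (t : Fin (n + 1) → unitInterval), StrictMono t →
    (∀ i, 0 < t i ∧ t i < 1) →
    HasLaw (fun ω i ↦ Y (t i) ω)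
      ((volume.restrict {x : Fin (n + 1) → ℝ | ∀ i, 0 < x i}).withDensity
        fun x ↦ ENNReal.ofReal (chainDensity a p b t x)) P
  continuous_paths : ∀ᵐ ω ∂P, Continuous fun t ↦ Y t ω

/-! ### Standard Brownian excursion -/

/-- The transition density of Brownian motion on `(0,∞)` killed at `0`:
`(2πt)^(-1/2) (exp (-(x-y)²/(2t)) - exp (-(x+y)²/(2t)))`. -/
noncomputable def killedKernel (t x y : ℝ) : ℝ :=
  (Real.exp (-(x - y) ^ 2 / (2 * t)) - Real.exp (-(x + y) ^ 2 / (2 * t))) / √(2 * Real.pi * t)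

/-- The density at time `t` of the first hitting time of `0` by Brownian motion started at `x > 0`:
`x (2πt³)^(-1/2) exp (-x²/(2t))`. -/
noncomputable def hittingDensity (t x : ℝ) : ℝ :=
  x / √(2 * Real.pi * t ^ 3) * Real.exp (-x ^ 2 / (2 * t))

/-- A standard (normalized) Brownian excursion: the continuous process on `[0,1]`, vanishing at `0`
and `1`, with the classical finite dimensional densities
`√(8π) h(t₀, x₀) (∏ i < n, p(tᵢ₊₁ - tᵢ, xᵢ, xᵢ₊₁)) h(1 - tₙ, xₙ)` on `(0,∞)ⁿ⁺¹`, where `p` is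
the transition density of killed Brownian motion and `h` the hitting density of `0`. -/
def IsStdBrownianExcursion {Ω : Type*} {mΩ : MeasurableSpace Ω}
    (Y : unitInterval → Ω → ℝ) (P : Measure Ω) : Prop :=
  IsPositiveBridgeWith (fun t x ↦ √(8 * Real.pi) * hittingDensity t x) killedKernel
    hittingDensity Y P

/-! ### Standard Bessel bridges -/

/-- The transition density of the Bessel process of dimension `d > 0` with respect to the measure
`y^(d-1) dy` on `(0,∞)`. With `ν = d/2 - 1` and `I_ν(z) = (z/2)^ν ∑ₖ (z/2)^(2k) / (k! Γ(k + ν + 1))`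
it equals `t⁻¹ (x y)^(-ν) exp (-(x² + y²)/(2t)) I_ν(x y / t)` for `x, y > 0`; here the factor
`(x y)^(-ν)` is cancelled against that of `I_ν`, so that the formula also holds for `x = 0` or
`y = 0`, by continuity. -/
noncomputable def besselKernel (d t x y : ℝ) : ℝ :=
  2 ^ (1 - d / 2) * t ^ (-(d / 2)) * Real.exp (-(x ^ 2 + y ^ 2) / (2 * t)) *
    ∑' k : ℕ, (x * y / (2 * t)) ^ (2 * k) / ((k.factorial : ℝ) * Real.Gamma (k + d / 2))

/-- The transition density `y^(d-1) q(t, x, y)` of the Bessel process of dimension `d > 0` with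
respect to Lebesgue measure on `(0,∞)`, from `x ≥ 0` to `y > 0`. -/
noncomputable def besselTransition (d t x y : ℝ) : ℝ :=
  y ^ (d - 1) * besselKernel d t x y

/-- A standard Bessel bridge of dimension `d`: the Bessel process of dimension `d` started at `0`
and conditioned to be at `0` at time `1`. It is the continuous process on `[0,1]`,
vanishing at `0` and `1`, for which `(Y t₀, …, Y tₙ)` has the density
`p(t₀, 0, x₀) (∏ i < n, p(tᵢ₊₁ - tᵢ, xᵢ, xᵢ₊₁)) q(1 - tₙ, xₙ, 0) / q(1, 0, 0)`, with `p` the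
transition density with respect to `dy` and `q` that with respect to `y^(d-1) dy`. -/
def IsStdBesselBridge {Ω : Type*} {mΩ : MeasurableSpace Ω} (d : ℝ)
    (Y : unitInterval → Ω → ℝ) (P : Measure Ω) : Prop :=
  IsPositiveBridgeWith (fun t y ↦ besselTransition d t 0 y) (besselTransition d)
    (fun t x ↦ besselKernel d t x 0 / besselKernel d 1 0 0) Y P

/-! ### The scaling factor of the space-time map -/

/-! Write c(v) for the scale and τ for the time change. The scale is affine with slope -k, c(0)c(1)
= 1, and since τ is a Möbius map, τ(w) - τ(v) = (w - v)/(c(v)c(w)) (`timeChange_sub`). For the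
Brownian bridge this already gives the covariance, as c(s)c(t)τ(s)(1 - τ(t)) = s(1 - t)/(c(0)c(1)).

For the other bridges, (v, x) ↦ (τ(v), x/c(v)) is a projective symmetry of the heat and Bessel
kernels: it changes a transition density by the Jacobian and a ratio G(v, x)/G(w, y), where G(v, x)
is a constant times c(v)^α exp(k c(v) x²/2), with α = 1/2 for killed Brownian motion and α = d/2 for
Bessel. These ratios telescope along a chain of times, and the entrance and exit factors absorb the
two ends (`chainDensity_eq_prod_mul`). The transformed process therefore has the original
finite-dimensional densities, which determine the law on the product space. -/

/-- The factor `(1 - u - v (uhat - u)) / √((1 - u) (1 - uhat))` by which `bridgeTransform`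
multiplies the space variable at time `v`. -/
noncomputable def bridgeScale (u uhat v : ℝ) : ℝ :=
  (1 - u - v * (uhat - u)) / √((1 - u) * (1 - uhat))

theorem continuous_bridgeScale (u uhat : ℝ) : Continuous (bridgeScale u uhat) := by
  unfold bridgeScale
  fun_prop

section Scale

variable {u uhat : ℝ}

theorem bridgeScale_numerator_pos (h : u < uhat) (hhat : uhat < 1) {v : ℝ} (h1 : v ≤ 1) :
    0 < 1 - u - v * (uhat - u) := by nlinarith

theorem sqrt_one_sub_mul_one_sub_pos (h : u < uhat) (hhat : uhat < 1) :
    0 < √((1 - u) * (1 - uhat)) :=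
  Real.sqrt_pos.2 (mul_pos (by linarith) (by linarith))

theorem sq_sqrt_one_sub_mul_one_sub (h : u < uhat) (hhat : uhat < 1) :
    √((1 - u) * (1 - uhat)) ^ 2 = (1 - u) * (1 - uhat) :=
  Real.sq_sqrt (mul_pos (by linarith) (by linarith)).le

theorem bridgeScale_pos (h : u < uhat) (hhat : uhat < 1) {v : ℝ} (h1 : v ≤ 1) :
    0 < bridgeScale u uhat v :=
  div_pos (bridgeScale_numerator_pos h hhat h1) (sqrt_one_sub_mul_one_sub_pos h hhat)

theorem bridgeScale_sub (u uhat v w : ℝ) :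
    bridgeScale u uhat v - bridgeScale u uhat w
      = (uhat - u) / √((1 - u) * (1 - uhat)) * (w - v) := by
  unfold bridgeScale
  ring

/-- This is what the normalisation by the square root achieves; all constants cancel through it. -/
theorem bridgeScale_zero_mul_one (h : u < uhat) (hhat : uhat < 1) :
    bridgeScale u uhat 0 * bridgeScale u uhat 1 = 1 := by
  have hK := sqrt_one_sub_mul_one_sub_pos h hhat
  have hK2 := sq_sqrt_one_sub_mul_one_sub h hhat
  unfold bridgeScale
  rw [div_mul_div_comm, div_eq_one_iff_eq (by positivity)]
  linear_combination -hK2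

@[simp]
theorem timeChange_zero (h : u < uhat) (hhat : uhat < 1) : timeChange h hhat 0 = 0 := by
  ext
  simp [timeChange]

@[simp]
theorem timeChange_one (h : u < uhat) (hhat : uhat < 1) : timeChange h hhat 1 = 1 := by
  have : (1 : ℝ) - uhat ≠ 0 := by linarith
  ext
  simp [timeChange, this]

theorem continuous_timeChange (h : u < uhat) (hhat : uhat < 1) :
    Continuous (timeChange h hhat) := by
  unfold timeChange
  refine Continuous.subtype_mk (Continuous.div (by fun_prop) (by fun_prop) fun v ↦ ?_) _
  exact (bridgeScale_numerator_pos h hhat v.2.2).ne'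

/-- A Möbius map has increments determinant · (w - v) over the product of the two denominators; here
the determinant (1 - u)(1 - uhat) is the square of the normalising root. -/
theorem timeChange_sub (h : u < uhat) (hhat : uhat < 1) (v w : unitInterval) :
    (timeChange h hhat w : ℝ) - timeChange h hhat v
      = ((w : ℝ) - v) / (bridgeScale u uhat v * bridgeScale u uhat w) := by
  have hK := sqrt_one_sub_mul_one_sub_pos h hhat
  have hK2 := sq_sqrt_one_sub_mul_one_sub h hhat
  have hv := bridgeScale_numerator_pos h hhat v.2.2
  have hw := bridgeScale_numerator_pos h hhat w.2.2
  unfold bridgeScale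
  rw [div_mul_div_comm, div_div_eq_mul_div, ← sq, hK2]
  simp only [timeChange]
  rw [div_sub_div _ _ hw.ne' hv.ne', div_eq_div_iff (by positivity) (by positivity)]
  ring

theorem strictMono_timeChange (h : u < uhat) (hhat : uhat < 1) :
    StrictMono (timeChange h hhat) := by
  intro v w hvw
  have hv := bridgeScale_pos h hhat v.2.2
  have hw := bridgeScale_pos h hhat w.2.2
  have hvw' : (0 : ℝ) < w - v := sub_pos.2 hvw
  have := timeChange_sub h hhat v w
  exact Subtype.coe_lt_coe.1 (sub_pos.1 (this ▸ div_pos hvw' (mul_pos hv hw)))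

theorem coe_timeChange (h : u < uhat) (hhat : uhat < 1) (v : unitInterval) :
    (timeChange h hhat v : ℝ) = v / (bridgeScale u uhat v * bridgeScale u uhat 0) := by
  simpa [mul_comm] using timeChange_sub h hhat 0 v

theorem one_sub_timeChange (h : u < uhat) (hhat : uhat < 1) (v : unitInterval) :
    1 - (timeChange h hhat v : ℝ)
      = (1 - (v : ℝ)) / (bridgeScale u uhat v * bridgeScale u uhat 1) := by
  simpa using timeChange_sub h hhat v 1

end Scale

/-! ### The transformed process, and laws of Gaussian bridges -/

section Processes

variable {Ω : Type*} {mΩ : MeasurableSpace Ω} {P : Measure Ω} {u uhat : ℝ}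

theorem bridgeTransform_apply (h : u < uhat) (hhat : uhat < 1) (Y : unitInterval → Ω → ℝ)
    (v : unitInterval) (ω : Ω) :
    bridgeTransform h hhat Y v ω = bridgeScale u uhat v * Y (timeChange h hhat v) ω := rfl

theorem bridgeTransform_eq (h : u < uhat) (hhat : uhat < 1) (Y : unitInterval → Ω → ℝ)
    (v : unitInterval) :
    bridgeTransform h hhat Y v = fun ω ↦ bridgeScale u uhat v * Y (timeChange h hhat v) ω := rfl

theorem measurable_bridgeTransform (h : u < uhat) (hhat : uhat < 1) {Y : unitInterval → Ω → ℝ}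
    (hY : ∀ t, Measurable (Y t)) (v : unitInterval) : Measurable (bridgeTransform h hhat Y v) :=
  (hY _).const_mul _

theorem ae_continuous_bridgeTransform (h : u < uhat) (hhat : uhat < 1) {Y : unitInterval → Ω → ℝ}
    (hY : ∀ᵐ ω ∂P, Continuous fun t ↦ Y t ω) :
    ∀ᵐ ω ∂P, Continuous fun v ↦ bridgeTransform h hhat Y v ω := by
  filter_upwards [hY] with ω hω
  exact ((continuous_bridgeScale u uhat).comp continuous_subtype_val).mul
    (hω.comp (continuous_timeChange h hhat))

/-! ### Brownian bridge -/

/-- Two jointly Gaussian finite families with the same means and covariances have the same law. -/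
theorem ProbabilityTheory.HasGaussianLaw.map_eq_of_covariance_eq {ι : Type*} [Fintype ι]
    {X Z : ι → Ω → ℝ} (hX : HasGaussianLaw (fun ω i ↦ X i ω) P)
    (hZ : HasGaussianLaw (fun ω i ↦ Z i ω) P)
    (hmean : ∀ i, ∫ ω, X i ω ∂P = ∫ ω, Z i ω ∂P)
    (hcov : ∀ i j, covariance (X i) (X j) P = covariance (Z i) (Z j) P) :
    P.map (fun ω i ↦ X i ω) = P.map (fun ω i ↦ Z i ω) := by
  have := hX.isProbabilityMeasure
  -- `covarianceBilin` lives on an inner product space, so the vectors are moved to `EuclideanSpace`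
  -- and compared there.
  have key : ∀ {W : ι → Ω → ℝ}, HasGaussianLaw (fun ω i ↦ W i ω) P →
      (P.map (fun ω i ↦ W i ω)).map (WithLp.toLp 2) = P.map (fun ω ↦ WithLp.toLp 2 (W · ω)) ∧
      IsGaussian (P.map (fun ω ↦ WithLp.toLp 2 (W · ω))) ∧
      (∀ i, (∫ x, x ∂(P.map (fun ω ↦ WithLp.toLp 2 (W · ω)))) i = ∫ ω, W i ω ∂P) ∧
      ∀ x y, covarianceBilin (P.map (fun ω ↦ WithLp.toLp 2 (W · ω))) x y
        = ∑ i, ∑ j, x i * y j * covariance (W i) (W j) P := by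
    intro W hW
    have hL : HasGaussianLaw (fun ω ↦ WithLp.toLp 2 (W · ω)) P :=
      hW.map (PiLp.continuousLinearEquiv 2 ℝ (fun _ : ι ↦ ℝ)).symm.toContinuousLinearMap
    refine ⟨?_, hL.isGaussian_map, fun i ↦ ?_, fun x y ↦ ?_⟩
    · rw [AEMeasurable.map_map_of_aemeasurable (by fun_prop) hW.aemeasurable]
      rfl
    · have hint : Integrable (fun x : EuclideanSpace ℝ ι ↦ x)
          (P.map (fun ω ↦ WithLp.toLp 2 (W · ω))) :=
        have := hL.isGaussian_map
        IsGaussian.integrable_id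
      have := (EuclideanSpace.proj (𝕜 := ℝ) i).integral_comp_comm hint
      refine this.symm.trans ?_
      rw [integral_map hL.aemeasurable (by fun_prop)]
      rfl
    · exact covarianceBilin_apply_pi (fun i ↦ (hW.eval i).memLp_two) x y
  obtain ⟨eX, gX, mX, cX⟩ := key hX
  obtain ⟨eZ, gZ, mZ, cZ⟩ := key hZ
  apply (MeasurableEquiv.toLp 2 (ι → ℝ)).map_measurableEquiv_injective
  rw [MeasurableEquiv.coe_toLp, eX, eZ]
  apply IsGaussian.ext
  · ext i
    simp only [id_eq]
    rw [mX, mZ, hmean]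
  · ext x y
    simp only [cX, cZ, hcov]

theorem IsStdBrownianBridge.identDistrib {X Z : unitInterval → Ω → ℝ}
    (hX : IsStdBrownianBridge X P) (hZ : IsStdBrownianBridge Z P)
    (mX : ∀ t, Measurable (X t)) (mZ : ∀ t, Measurable (Z t)) :
    IdentDistrib (fun ω v ↦ X v ω) (fun ω v ↦ Z v ω) P P := by
  have := hX.isGaussianProcess.isProbabilityMeasure
  have aX := (measurable_pi_lambda (fun ω v ↦ X v ω) mX).aemeasurable (μ := P)
  have aZ := (measurable_pi_lambda (fun ω v ↦ Z v ω) mZ).aemeasurable (μ := P)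
  refine ⟨aX, aZ, (map_eq_iff_forall_finset_map_restrict_eq aX aZ).2 fun I ↦ ?_⟩
  refine (hX.isGaussianProcess.hasGaussianLaw I).map_eq_of_covariance_eq
    (X := fun (i : I) ω ↦ X i ω) (Z := fun (i : I) ω ↦ Z i ω)
    (hZ.isGaussianProcess.hasGaussianLaw I) (fun i ↦ ?_) fun i j ↦ ?_
  · rw [hX.mean_eq_zero, hZ.mean_eq_zero]
  · rcases le_total i.1 j.1 with hij | hij
    · rw [hX.covariance_eq _ _ hij, hZ.covariance_eq _ _ hij]
    · rw [covariance_comm, hX.covariance_eq _ _ hij, covariance_comm, hZ.covariance_eq _ _ hij]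

theorem IsStdBrownianBridge.bridgeTransform {Y : unitInterval → Ω → ℝ}
    (hY : IsStdBrownianBridge Y P) (h : u < uhat) (hhat : uhat < 1) :
    IsStdBrownianBridge (bridgeTransform h hhat Y) P where
  isGaussianProcess :=
    (IsGaussianProcess.smul (fun v : unitInterval ↦ bridgeScale u uhat v)
      (hY.isGaussianProcess.comp_right (timeChange h hhat)) :)
  mean_eq_zero t := by
    simp only [bridgeTransform_apply]
    rw [integral_const_mul, hY.mean_eq_zero, mul_zero]
  covariance_eq s t hst := by
    have hs := (bridgeScale_pos h hhat s.2.2).ne'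
    have ht := (bridgeScale_pos h hhat t.2.2).ne'
    have h01 := bridgeScale_zero_mul_one h hhat
    have h0 := left_ne_zero_of_mul_eq_one h01
    have h1 := right_ne_zero_of_mul_eq_one h01
    simp only [bridgeTransform_eq]
    rw [covariance_const_mul_left, covariance_const_mul_right,
      hY.covariance_eq _ _ ((strictMono_timeChange h hhat).monotone hst),
      coe_timeChange, one_sub_timeChange]
    field_simp
    linear_combination (-(s : ℝ) * (1 - t)) * h01
  continuous_paths := ae_continuous_bridgeTransform h hhat hY.continuous_paths

end Processes

/-! ### Uniqueness and change of scale for positive bridges -/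

/-- Rescaling the coordinates by positive factors transforms densities on the positive orthant by
the Jacobian. -/
theorem map_mul_withDensity_restrict_pos {ι : Type*} [Fintype ι] {c : ι → ℝ} (hc : ∀ i, 0 < c i)
    {f g : (ι → ℝ) → ℝ}
    (hfg : ∀ x, (∀ i, 0 < x i) → f x = (∏ i, c i) * g fun i ↦ c i * x i) :
    ((volume.restrict {x : ι → ℝ | ∀ i, 0 < x i}).withDensity fun x ↦ ENNReal.ofReal (f x)).map
        (fun x i ↦ c i * x i)
      = (volume.restrict {x : ι → ℝ | ∀ i, 0 < x i}).withDensity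
        fun x ↦ ENNReal.ofReal (g x) := by
  classical
  let e : (ι → ℝ) ≃ᵐ (ι → ℝ) := MeasurableEquiv.piCongrRight fun i ↦
    (Homeomorph.mulLeft₀ (c i) (hc i).ne').toMeasurableEquiv
  have he : (fun (x : ι → ℝ) i ↦ c i * x i) = e := rfl
  have hprod : 0 < ∏ i, c i := Finset.prod_pos fun i _ ↦ hc i
  have hvol : ENNReal.ofReal (∏ i, c i) • (volume : Measure (ι → ℝ)).map e = volume := by
    have := Real.smul_map_diagonal_volume_pi (ι := ι) (D := c)
      (by rw [Matrix.det_diagonal]; exact hprod.ne')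
    rw [Matrix.det_diagonal, abs_of_pos hprod] at this
    convert this using 3
    ext x i
    simp [← he, Matrix.mulVec_diagonal]
  have hpos : MeasurableSet {x : ι → ℝ | ∀ i, 0 < x i} := by
    rw [Set.ofPred_forall]
    exact MeasurableSet.iInter fun i ↦ measurableSet_lt measurable_const (measurable_pi_apply i)
  have hpre : e ⁻¹' {x : ι → ℝ | ∀ i, 0 < x i} = {x | ∀ i, 0 < x i} := by
    ext x
    simp [← he, hc]
  rw [he]
  ext s hs
  rw [e.map_apply, withDensity_apply _ (e.measurable hs), withDensity_apply _ hs,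
    Measure.restrict_restrict (e.measurable hs), Measure.restrict_restrict hs]
  calc ∫⁻ x in e ⁻¹' s ∩ {x | ∀ i, 0 < x i}, ENNReal.ofReal (f x)
      = ∫⁻ x in e ⁻¹' (s ∩ {x | ∀ i, 0 < x i}),
          ENNReal.ofReal (∏ i, c i) * ENNReal.ofReal (g (e x)) := by
        rw [Set.preimage_inter, hpre]
        refine setLIntegral_congr_fun ((e.measurable hs).inter hpos) fun x hx ↦ ?_
        rw [hfg x hx.2, ENNReal.ofReal_mul hprod.le]
        rfl
    _ = ∫⁻ x in s ∩ {x | ∀ i, 0 < x i}, ENNReal.ofReal (g x) := by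
        conv_rhs => rw [← hvol]
        rw [lintegral_const_mul' _ _ ENNReal.ofReal_ne_top, Measure.restrict_smul,
          lintegral_smul_measure, e.restrict_map, lintegral_map_equiv, smul_eq_mul]

/-- If the factors of a chain density rescale with multiplicative correction factors `g`, then these
telescope. -/
theorem chainDensity_eq_prod_mul {a : ℝ → ℝ → ℝ} {p : ℝ → ℝ → ℝ → ℝ} {b : ℝ → ℝ → ℝ} {n : ℕ}
    {s t : Fin (n + 1) → unitInterval} {x c g : Fin (n + 1) → ℝ} (hg : ∀ i, g i ≠ 0)
    (ha : a (s 0) (x 0) * g 0 = c 0 * a (t 0) (c 0 * x 0))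
    (hp : ∀ i : Fin n,
      p ((s i.succ : ℝ) - s i.castSucc) (x i.castSucc) (x i.succ) * g i.succ
        = c i.succ * g i.castSucc * p ((t i.succ : ℝ) - t i.castSucc)
          (c i.castSucc * x i.castSucc) (c i.succ * x i.succ))
    (hb : b (1 - (s (Fin.last n) : ℝ)) (x (Fin.last n))
      = g (Fin.last n) * b (1 - (t (Fin.last n) : ℝ)) (c (Fin.last n) * x (Fin.last n))) :
    chainDensity a p b s x = (∏ i, c i) * chainDensity a p b t fun i ↦ c i * x i := by
  have hp' := Finset.prod_congr (rfl : (Finset.univ : Finset (Fin n)) = _) fun i _ ↦ hp i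
  simp only [Finset.prod_mul_distrib] at hp'
  have hg1 := Fin.prod_univ_succ g
  have hg2 := Fin.prod_univ_castSucc g
  -- Multiplying by the full product of `g` avoids quotients: it is split at the first index on the
  -- left and at the last on the right.
  refine mul_right_cancel₀ (Finset.prod_ne_zero_iff.2 fun i _ ↦ hg i : ∏ i, g i ≠ 0) ?_
  unfold chainDensity
  rw [hb, Fin.prod_univ_succ c]
  conv_lhs => rw [hg1]
  conv_rhs => rw [hg2]
  linear_combination
    (∏ i : Fin n, p ((s i.succ : ℝ) - s i.castSucc) (x i.castSucc) (x i.succ)) *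
      (g (Fin.last n) * b (1 - (t (Fin.last n) : ℝ)) (c (Fin.last n) * x (Fin.last n))) *
      (∏ i : Fin n, g i.succ) * ha +
    (g (Fin.last n) * b (1 - (t (Fin.last n) : ℝ)) (c (Fin.last n) * x (Fin.last n))) *
      (c 0 * a (t 0) (c 0 * x 0)) * hp'

section PositiveBridge

variable {Ω : Type*} {mΩ : MeasurableSpace Ω} {P : Measure Ω} {u uhat : ℝ}
  {a : ℝ → ℝ → ℝ} {p : ℝ → ℝ → ℝ → ℝ} {b : ℝ → ℝ → ℝ}

theorem IsPositiveBridgeWith.identDistrib [IsFiniteMeasure P] {X Z : unitInterval → Ω → ℝ}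
    (hX : IsPositiveBridgeWith a p b X P) (hZ : IsPositiveBridgeWith a p b Z P)
    (mX : ∀ t, Measurable (X t)) (mZ : ∀ t, Measurable (Z t)) :
    IdentDistrib (fun ω v ↦ X v ω) (fun ω v ↦ Z v ω) P P := by
  classical
  have aX := (measurable_pi_lambda (fun ω v ↦ X v ω) mX).aemeasurable (μ := P)
  have aZ := (measurable_pi_lambda (fun ω v ↦ Z v ω) mZ).aemeasurable (μ := P)
  refine ⟨aX, aZ, (map_eq_iff_forall_finset_map_restrict_eq aX aZ).2 fun I ↦ ?_⟩
  -- `hasLaw` needs at least one interior time; adding 1/2 covers the case where `I` has none.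
  let half : unitInterval := ⟨1 / 2, by constructor <;> norm_num⟩
  let J : Finset unitInterval := insert half (I.filter fun t ↦ 0 < t ∧ t < 1)
  have hJ : ∀ t ∈ J, 0 < t ∧ t < 1 := by
    intro t ht
    rcases Finset.mem_insert.1 ht with rfl | ht
    · constructor
      · change (0 : ℝ) < 1 / 2
        norm_num
      · change (1 / 2 : ℝ) < 1
        norm_num
    · exact (Finset.mem_filter.1 ht).2
  obtain ⟨n, hn⟩ : ∃ n, J.card = n + 1 :=
    Nat.exists_eq_succ_of_ne_zero (Finset.card_ne_zero_of_mem (Finset.mem_insert_self _ _))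
  let t : Fin (n + 1) → unitInterval := J.orderEmbOfFin hn
  have ht : ∀ r ∈ J, ∃ i, t i = r := fun r hr ↦ by
    have : r ∈ Set.range (J.orderEmbOfFin hn) := by rwa [Finset.range_orderEmbOfFin]
    exact this
  have hlaw := fun {W : unitInterval → Ω → ℝ} (hW : IsPositiveBridgeWith a p b W P) ↦
    hW.hasLaw n t (J.orderEmbOfFin hn).strictMono fun i ↦ hJ _ (J.orderEmbOfFin_mem hn i)
  have hcases : ∀ i : I, i.1 = 0 ∨ i.1 = 1 ∨ ∃ k, t k = i.1 := by
    intro i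
    by_cases h0 : i.1 = 0
    · exact Or.inl h0
    by_cases h1 : i.1 = 1
    · exact Or.inr (Or.inl h1)
    · exact Or.inr (Or.inr (ht _ (Finset.mem_insert_of_mem (Finset.mem_filter.2
        ⟨i.2, unitInterval.pos_iff_ne_zero.2 h0, unitInterval.lt_one_iff_ne_one.2 h1⟩))))
  -- The default value 0 serves the times 0 and 1, where the process vanishes almost surely.
  let Φ : (Fin (n + 1) → ℝ) → I → ℝ := fun x i ↦
    if hi : ∃ k, t k = i.1 then x hi.choose else 0
  have hΦ : Measurable Φ := by
    refine measurable_pi_lambda _ fun i ↦ ?_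
    by_cases hi : ∃ k, t k = i.1
    · simpa only [Φ, dif_pos hi] using measurable_pi_apply _
    · simpa only [Φ, dif_neg hi] using measurable_const
  have key : ∀ {W : unitInterval → Ω → ℝ}, IsPositiveBridgeWith a p b W P →
      P.map (fun ω ↦ I.restrict (W · ω)) = (P.map fun ω i ↦ W (t i) ω).map Φ := by
    intro W hW
    rw [AEMeasurable.map_map_of_aemeasurable hΦ.aemeasurable (hlaw hW).aemeasurable]
    refine Measure.map_congr ?_
    filter_upwards [hW.start_eq_zero, hW.end_eq_zero] with ω h0 h1
    ext i
    simp only [Finset.restrict, Function.comp, Φ]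
    split_ifs with hi
    · rw [hi.choose_spec]
    · rcases hcases i with h | h | h
      · rw [h, h0]
      · rw [h, h1]
      · exact absurd h hi
  rw [key hX, key hZ, (hlaw hX).map_eq, (hlaw hZ).map_eq]

/-- `G` is a Doob-type factor in the original space variable: it enters with `a`, is passed on by
each `p`, and leaves with `b`. The factors of `bridgeScale` left over form the Jacobian. -/
theorem IsPositiveBridgeWith.bridgeTransform {Y : unitInterval → Ω → ℝ}
    (hY : IsPositiveBridgeWith a p b Y P) (h : u < uhat) (hhat : uhat < 1)
    (G : unitInterval → ℝ → ℝ) (hG : ∀ v x, G v x ≠ 0)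
    (ha : ∀ v : unitInterval, 0 < v → ∀ x, 0 < x →
      a (timeChange h hhat v) x * G v x
        = bridgeScale u uhat v * a v (bridgeScale u uhat v * x))
    (hp : ∀ v w : unitInterval, v < w → ∀ x y, 0 < x → 0 < y →
      p ((timeChange h hhat w : ℝ) - timeChange h hhat v) x y * G w y
        = bridgeScale u uhat w * G v x *
          p ((w : ℝ) - v) (bridgeScale u uhat v * x) (bridgeScale u uhat w * y))
    (hb : ∀ v : unitInterval, v < 1 → ∀ x, 0 < x →
      b (1 - (timeChange h hhat v : ℝ)) x = G v x * b (1 - (v : ℝ)) (bridgeScale u uhat v * x)) :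
    IsPositiveBridgeWith a p b (bridgeTransform h hhat Y) P where
  start_eq_zero := by
    filter_upwards [hY.start_eq_zero] with ω hω
    rw [bridgeTransform_apply, timeChange_zero, hω, mul_zero]
  end_eq_zero := by
    filter_upwards [hY.end_eq_zero] with ω hω
    rw [bridgeTransform_apply, timeChange_one, hω, mul_zero]
  hasLaw n t ht ht01 := by
    have hmono := strictMono_timeChange h hhat
    have hlaw := hY.hasLaw n (timeChange h hhat ∘ t) (hmono.comp ht) fun i ↦
      ⟨by simpa using hmono (ht01 i).1, by simpa using hmono (ht01 i).2⟩
    have hmeas : Measurable fun (x : Fin (n + 1) → ℝ) i ↦ bridgeScale u uhat (t i) * x i := by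
      fun_prop
    refine ⟨hmeas.comp_aemeasurable hlaw.aemeasurable, ?_⟩
    rw [← map_mul_withDensity_restrict_pos (fun i ↦ bridgeScale_pos h hhat (t i).2.2)
      (fun x hx ↦ chainDensity_eq_prod_mul (s := timeChange h hhat ∘ t)
        (g := fun i ↦ G (t i) (x i)) (fun i ↦ hG _ _)
        (ha _ (ht01 0).1 _ (hx 0))
        (fun i ↦ hp _ _ (ht Fin.castSucc_lt_succ) _ _ (hx _) (hx _))
        (hb _ (ht01 _).2 _ (hx _))), ← hlaw.map_eq,
      AEMeasurable.map_map_of_aemeasurable hmeas.aemeasurable hlaw.aemeasurable]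
    rfl
  continuous_paths := ae_continuous_bridgeTransform h hhat hY.continuous_paths

end PositiveBridge

/-! ### Scaling of the kernels -/

section Kernels

variable {c c' k δ : ℝ}

theorem hittingDensity_div_mul (hc : 0 < c) (hc' : 0 < c') (hδ : 0 < δ) (hk : c - c' = k * δ)
    (x : ℝ) :
    hittingDensity (δ / (c * c')) x
      = √c * (c' * √c') * Real.exp (k * c * x ^ 2 / 2) * hittingDensity δ (c * x) := by
  have hs : √(2 * Real.pi * (δ / (c * c')) ^ 3)
      = √(2 * Real.pi * δ ^ 3) / (c * √c * (c' * √c')) := by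
    rw [← Real.sqrt_sq (by positivity : 0 ≤ c * √c * (c' * √c')), ← Real.sqrt_div (by positivity)]
    congr 1
    simp only [mul_pow, Real.sq_sqrt hc.le, Real.sq_sqrt hc'.le]
    field_simp
  have he : Real.exp (-x ^ 2 / (2 * (δ / (c * c'))))
      = Real.exp (k * c * x ^ 2 / 2) * Real.exp (-(c * x) ^ 2 / (2 * δ)) := by
    rw [← Real.exp_add]
    congr 1
    field_simp
    linear_combination x ^ 2 * hk
  unfold hittingDensity
  rw [hs, he]
  have : 0 < √(2 * Real.pi * δ ^ 3) := by positivity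
  field_simp

theorem killedKernel_div_mul (hc : 0 < c) (hc' : 0 < c') (hδ : 0 < δ) (hk : c - c' = k * δ)
    (x y : ℝ) :
    killedKernel (δ / (c * c')) x y * (√c' * Real.exp (k * c' * y ^ 2 / 2))
      = c' * (√c * Real.exp (k * c * x ^ 2 / 2)) * killedKernel δ (c * x) (c' * y) := by
  have hs : √(2 * Real.pi * (δ / (c * c'))) = √(2 * Real.pi * δ) / (√c * √c') := by
    rw [← Real.sqrt_mul hc.le, ← Real.sqrt_div (by positivity), mul_div_assoc]
  -- Used at z = y and z = -y: the correction is even in z, so the direct and reflected Gaussians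
  -- share it.
  have he : ∀ z : ℝ, Real.exp (-(x - z) ^ 2 / (2 * (δ / (c * c')))) *
      Real.exp (k * c' * z ^ 2 / 2)
        = Real.exp (k * c * x ^ 2 / 2) * Real.exp (-(c * x - c' * z) ^ 2 / (2 * δ)) := by
    intro z
    rw [← Real.exp_add, ← Real.exp_add]
    congr 1
    field_simp
    linear_combination (c * x ^ 2 - c' * z ^ 2) * hk
  have h1 := he y
  have h2 := he (-y)
  rw [sub_neg_eq_add, neg_sq, mul_neg, sub_neg_eq_add] at h2
  have hs' : √c' ^ 2 = c' := Real.sq_sqrt hc'.le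
  have : 0 < √(2 * Real.pi * δ) := by positivity
  unfold killedKernel
  rw [hs]
  generalize Real.exp (-(x - y) ^ 2 / (2 * (δ / (c * c')))) = e₁ at h1 ⊢
  generalize Real.exp (-(x + y) ^ 2 / (2 * (δ / (c * c')))) = e₂ at h2 ⊢
  generalize Real.exp (k * c' * y ^ 2 / 2) = e₃ at h1 h2 ⊢
  generalize Real.exp (k * c * x ^ 2 / 2) = e₄ at h1 h2 ⊢
  generalize Real.exp (-(c * x - c' * y) ^ 2 / (2 * δ)) = e₅ at h1 ⊢
  generalize Real.exp (-(c * x + c' * y) ^ 2 / (2 * δ)) = e₆ at h2 ⊢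
  field_simp
  rw [hs']
  linear_combination c' * h1 - c' * h2

/-- The series depends only on xy/t, which is invariant; only the power of t and the Gaussian factor
change. -/
theorem besselKernel_div_mul (d : ℝ) (hc : 0 < c) (hc' : 0 < c') (hδ : 0 < δ)
    (hk : c - c' = k * δ) (x y : ℝ) :
    besselKernel d (δ / (c * c')) x y * Real.exp (k * c' * y ^ 2 / 2)
      = c ^ (d / 2) * c' ^ (d / 2) * Real.exp (k * c * x ^ 2 / 2) *
        besselKernel d δ (c * x) (c' * y) := by
  have he : Real.exp (-(x ^ 2 + y ^ 2) / (2 * (δ / (c * c')))) * Real.exp (k * c' * y ^ 2 / 2)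
        = Real.exp (k * c * x ^ 2 / 2) *
          Real.exp (-((c * x) ^ 2 + (c' * y) ^ 2) / (2 * δ)) := by
    rw [← Real.exp_add, ← Real.exp_add]
    congr 1
    field_simp
    linear_combination (c * x ^ 2 - c' * y ^ 2) * hk
  have hpow : (δ / (c * c')) ^ (-(d / 2)) = δ ^ (-(d / 2)) * (c ^ (d / 2) * c' ^ (d / 2)) := by
    rw [Real.div_rpow hδ.le (by positivity), Real.rpow_neg (by positivity : 0 ≤ c * c'),
      div_inv_eq_mul, Real.mul_rpow hc.le hc'.le]
  have hseries : x * y / (2 * (δ / (c * c'))) = c * x * (c' * y) / (2 * δ) := by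
    field_simp
  unfold besselKernel
  rw [hpow, hseries]
  linear_combination (2 ^ (1 - d / 2) * (δ ^ (-(d / 2)) * (c ^ (d / 2) * c' ^ (d / 2))) *
    ∑' j : ℕ, (c * x * (c' * y) / (2 * δ)) ^ (2 * j) /
      ((j.factorial : ℝ) * Real.Gamma (j + d / 2))) * he

theorem besselTransition_div_mul (d : ℝ) (hc : 0 < c) (hc' : 0 < c') (hδ : 0 < δ)
    (hk : c - c' = k * δ) (x : ℝ) {y : ℝ} (hy : 0 < y) :
    besselTransition d (δ / (c * c')) x y * (c' ^ (d / 2) * Real.exp (k * c' * y ^ 2 / 2))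
      = c' * (c ^ (d / 2) * Real.exp (k * c * x ^ 2 / 2)) *
        besselTransition d δ (c * x) (c' * y) := by
  -- This turns the symmetric factor of the kernel into a ratio, the Jacobian c' and the change of
  -- the weight y^(d-1).
  have hpow : c' ^ (d / 2) * c' ^ (d / 2) = c' * c' ^ (d - 1) := by
    rw [← Real.rpow_add hc', add_halves, Real.rpow_sub_one hc'.ne']
    field_simp
  unfold besselTransition
  rw [Real.mul_rpow hc'.le hy.le]
  linear_combination y ^ (d - 1) * c' ^ (d / 2) * besselKernel_div_mul d hc hc' hδ hk x y +
    y ^ (d - 1) * c ^ (d / 2) * Real.exp (k * c * x ^ 2 / 2) *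
      besselKernel d δ (c * x) (c' * y) * hpow

end Kernels

/-! ### Invariance of excursions and Bessel bridges; conclusion -/

section Processes

variable {Ω : Type*} {mΩ : MeasurableSpace Ω} {P : Measure Ω} {u uhat : ℝ}

theorem IsStdBrownianExcursion.bridgeTransform {Y : unitInterval → Ω → ℝ}
    (hY : IsStdBrownianExcursion Y P) (h : u < uhat) (hhat : uhat < 1) :
    IsStdBrownianExcursion (bridgeTransform h hhat Y) P := by
  let c := bridgeScale u uhat
  let k := (uhat - u) / √((1 - u) * (1 - uhat))
  have hc : ∀ v : unitInterval, 0 < c v := fun v ↦ bridgeScale_pos h hhat v.2.2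
  have hc0 : 0 < c 0 := bridgeScale_pos h hhat zero_le_one
  have hc1 : 0 < c 1 := bridgeScale_pos h hhat le_rfl
  have hk : ∀ v w : ℝ, c v - c w = k * (w - v) := bridgeScale_sub u uhat
  have h01 : c 0 * c 1 = 1 := bridgeScale_zero_mul_one h hhat
  refine IsPositiveBridgeWith.bridgeTransform hY h hhat
    -- The constant c(1)^(3/2) is dictated by the exit factor; at the entrance it meets c(0)^(3/2)
    -- and cancels.
    (fun v x ↦ c 1 * √(c 1) * (√(c v) * Real.exp (k * c v * x ^ 2 / 2)))
    (fun v x ↦ ?_) (fun v hv x _ ↦ ?_) (fun v w hvw x y _ _ ↦ ?_) fun v hv x _ ↦ ?_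
  · have := hc v
    positivity
  · have hs : √(c 0) * √(c 1) = 1 := by rw [← Real.sqrt_mul hc0.le, h01, Real.sqrt_one]
    have hcv := Real.sq_sqrt (hc v).le
    have hexp : Real.exp (-k * c v * x ^ 2 / 2) * Real.exp (k * c v * x ^ 2 / 2) = 1 := by
      rw [← Real.exp_add]
      ring_nf
      exact Real.exp_zero
    -- At the entrance the time runs back to 0 and c(v) - c(0) = -k v, so the exponential is the
    -- inverse of the one in `G`.
    rw [coe_timeChange, hittingDensity_div_mul (k := -k) (hc v) hc0 hv
      (by rw [hk]; ring) x]
    change _ = c v * (√(8 * Real.pi) * hittingDensity v (c v * x))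
    calc _ = √(8 * Real.pi) * hittingDensity v (c v * x) * √(c v) ^ 2 * (c 0 * c 1) *
          (√(c 0) * √(c 1)) *
          (Real.exp (-k * c v * x ^ 2 / 2) * Real.exp (k * c v * x ^ 2 / 2)) := by ring
      _ = _ := by rw [hs, hcv, hexp, h01]; ring
  · rw [timeChange_sub]
    linear_combination c 1 * √(c 1) *
      killedKernel_div_mul (hc v) (hc w) (sub_pos.2 hvw) (hk v w) x y
  · rw [one_sub_timeChange,
      hittingDensity_div_mul (hc v) hc1 (sub_pos.2 hv : (0 : ℝ) < 1 - v) (hk v 1) x]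
    ring

theorem IsStdBesselBridge.bridgeTransform {d : ℝ} {Y : unitInterval → Ω → ℝ}
    (hY : IsStdBesselBridge d Y P) (h : u < uhat) (hhat : uhat < 1) :
    IsStdBesselBridge d (bridgeTransform h hhat Y) P := by
  let c := bridgeScale u uhat
  let k := (uhat - u) / √((1 - u) * (1 - uhat))
  have hc : ∀ v : unitInterval, 0 < c v := fun v ↦ bridgeScale_pos h hhat v.2.2
  have hc0 : 0 < c 0 := bridgeScale_pos h hhat zero_le_one
  have hc1 : 0 < c 1 := bridgeScale_pos h hhat le_rfl
  have hk : ∀ v w : ℝ, c v - c w = k * (w - v) := bridgeScale_sub u uhat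
  have h01 : c 0 * c 1 = 1 := bridgeScale_zero_mul_one h hhat
  refine IsPositiveBridgeWith.bridgeTransform hY h hhat
    (fun v x ↦ c 1 ^ (d / 2) * (c v ^ (d / 2) * Real.exp (k * c v * x ^ 2 / 2)))
    (fun v x ↦ ?_) (fun v hv x hx ↦ ?_) (fun v w hvw x y _ hy ↦ ?_) fun v hv x _ ↦ ?_
  · have := hc v
    positivity
  · have hs : c 0 ^ (d / 2) * c 1 ^ (d / 2) = 1 := by
      rw [← Real.mul_rpow hc0.le hc1.le, h01, Real.one_rpow]
    -- Starting from 0 makes the initial exponential trivial, leaving only c(0)^(d/2) to cancel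
    -- c(1)^(d/2).
    have key := besselTransition_div_mul d hc0 (hc v) (by simpa using hv)
      (by rw [hk] : c 0 - c v = k * (v - 0)) 0 hx
    rw [sub_zero, mul_zero, zero_pow two_ne_zero, mul_zero, zero_div, Real.exp_zero] at key
    rw [coe_timeChange, mul_comm (bridgeScale u uhat v)]
    change _ = c v * besselTransition d v 0 (c v * x)
    linear_combination c 1 ^ (d / 2) * key + c v * besselTransition d v 0 (c v * x) * hs
  · rw [timeChange_sub]
    linear_combination c 1 ^ (d / 2) *
      besselTransition_div_mul d (hc v) (hc w) (sub_pos.2 hvw) (hk v w) x hy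
  · have key := besselKernel_div_mul d (hc v) hc1 (sub_pos.2 hv : (0 : ℝ) < 1 - v) (hk v 1) x 0
    rw [zero_pow two_ne_zero, mul_zero, zero_div, Real.exp_zero, mul_zero] at key
    rw [one_sub_timeChange]
    linear_combination (besselKernel d 1 0 0)⁻¹ * key

end Processes

theorem mainTheorem7 {Ω : Type*} {mΩ : MeasurableSpace Ω} (P : Measure Ω) [IsProbabilityMeasure P]
    (u uhat : ℝ) (hu : 0 ≤ u) (h : u < uhat) (hhat : uhat < 1)
    (Y : unitInterval → Ω → ℝ) (hY : ∀ t, Measurable (Y t)) :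
    (IsStdBrownianBridge Y P →
      IdentDistrib (fun ω v ↦ bridgeTransform h hhat Y v ω) (fun ω v ↦ Y v ω) P P ∧
        ∀ᵐ ω ∂P, Continuous fun v ↦ bridgeTransform h hhat Y v ω) ∧
    (IsStdBrownianExcursion Y P →
      IdentDistrib (fun ω v ↦ bridgeTransform h hhat Y v ω) (fun ω v ↦ Y v ω) P P ∧
        ∀ᵐ ω ∂P, Continuous fun v ↦ bridgeTransform h hhat Y v ω) ∧
    (∀ d : ℝ, 0 < d → IsStdBesselBridge d Y P →
      IdentDistrib (fun ω v ↦ bridgeTransform h hhat Y v ω) (fun ω v ↦ Y v ω) P P ∧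
        ∀ᵐ ω ∂P, Continuous fun v ↦ bridgeTransform h hhat Y v ω) := by
  have hX := measurable_bridgeTransform h hhat hY
  refine ⟨fun hB ↦ ?_, fun hB ↦ ?_, fun d _ hB ↦ ?_⟩
  · exact ⟨(hB.bridgeTransform h hhat).identDistrib hB hX hY,
      (hB.bridgeTransform h hhat).continuous_paths⟩
  · have hT : IsPositiveBridgeWith _ _ _ (bridgeTransform h hhat Y) P := hB.bridgeTransform h hhat
    exact ⟨hT.identDistrib hB hX hY, hT.continuous_paths⟩
  · have hT : IsPositiveBridgeWith _ _ _ (bridgeTransform h hhat Y) P := hB.bridgeTransform h hhat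
    exact ⟨hT.identDistrib hB hX hY, hT.continuous_paths⟩
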